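/- Let $X$ be a real reflexive Banach space, $(\Omega,\Sigma)$ a measurable space and $m:\Sigma\to X$ a countably additive vector measure. Let $1\le p,p'\le\infty$ with $\frac1p+\frac1{p'}=1$. For $1\le r<\infty$, $L^r(m)$ is the space of (classes modulo $m$-null sets of) measurable $f:\Omega\to\mathbb R$ such that $|f|^r$ is integrable with respect to $m$ (that is, $|f|^r$ is integrable with respect to every $|\langle m,x^*\rangle|$, $x^*\in X^*$, and for every $A\in\Sigma$ there is $x_A\in X$ with $\langle x_A,x^*\rangle=\int_A|f|^r\,d\langle m,x^*\rangle$ for all $x^*\in X^*$), with the norm $\|f\|=\sup_{x^*\in B_{X^*}}\big(\int|f|^r\,d|\langle m,x^*\rangle|\big)^{1/r}$; $L^\infty(m)$ is the space of $m$-essentially bounded functions with the essential supremum norm. For $f\in L^p(m)$, $g\in L^{p'}(m)$ the product $fg$ is $m$-integrable, and $\int fg\,dm\in X$ denotes its integral over $\Omega$. $B_S$ is the closed unit ball of a normed space $S$. Let $P\subseteq P^{mm}\subseteq L^p(m)$ and $P^m\subseteq L^{p'}(m)$ be linear subspaces such that $f\mapsto\sup_{g\in B_{P^m}}\|\int fg\,dm\|$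 is a norm on $P$ equivalent to that of $L^p(m)$ and $g\mapsto\sup_{f\in B_{P^{mm}}}\|\int fg\,dm\|$ is a norm on $P^m$ equivalent to that of $L^{p'}(m)$ (an $m$-dual system). Let $\tau_m(P^m)$ be the topology on $P$ defined by the seminorms $f\mapsto\|\int fg\,dm\|$, $g\in P^m$, and $\tau_m(P^{mm})$ the topology on $P^m$ defined by the seminorms $g\mapsto\|\int fg\,dm\|$, $f\in P^{mm}$. Let $1\le q<\infty$. A continuous linear operator $T$ from $P$ to a normed space $E$ is called $(q,P^m)$-summing if there is a constant $K$ such that for all finite families $f_1,\dots,f_n\in P$, $$\Big(\sum_{i=1}^n\|T(f_i)\|^q\Big)^{1/q}\le K\sup_{g\in B_{P^m}}\Big(\sum_{i=1}^n\Big\|\int f_i\,g\,dm\Big\|^q\Big)^{1/q}.$$ Suppose that $B_P$ is $\tau_m(P^m)$-compact and $B_{P^m}$ is $\tau_m(P^{mm})$-compact. Then: 1. If $T:P\to P$ is $(q,P^m)$-summing, then $T\circ T$ is compact. 2. If there are a normed space $E$ and a $(q,P^m)$-summing operator $T:P\to E$ that is an isomorphism onto its range (that is, $c\|f\|\le\|T(f)\|$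 for some $c>0$ and all $f\in P$), then $P$ is finite dimensional. In particular this holds if $P$ admits a $(q,P^m)$-summing isomorphism onto a Banach space, for instance onto $P$ itself. -/

import Mathlib

open MeasureTheory Set
open scoped ENNReal NNReal Topology

namespace VectorMeasureLp

variable {Ω : Type*} {mΩ : MeasurableSpace Ω} {X : Type*} [NormedAddCommGroup X] [NormedSpace ℝ X]

/-- The real measure `⟨m, x'⟩ : A ↦ x' (m A)`. -/
noncomputable def scalarize (m : VectorMeasure Ω X) (x' : StrongDual ℝ X) : SignedMeasure Ω :=
  m.mapRange (x' : X →+ ℝ) x'.continuous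

/-- `x` is the (weakly defined) integral of `f` over `A` with respect to `m`, i.e.
`⟨x, x'⟩ = ∫_A f d⟨m, x'⟩` for all `x'` in the dual of `X`. -/
def IsIntegralOn (m : VectorMeasure Ω X) (f : Ω → ℝ) (A : Set Ω) (x : X) : Prop :=
  ∀ x' : StrongDual ℝ X, x' x = ∫ᵛ ω in A, f ω ∂•(scalarize m x')

/-- `f` is integrable with respect to the vector measure `m`: it is integrable with respect to all
the measures `|⟨m, x'⟩|`, and for every measurable `A` the integral of `f` over `A` exists in `X`.
The `m`-null sets are the null sets of the variation `|m|` (equivalently of any Rybakov measure). -/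
def VMIntegrable (m : VectorMeasure Ω X) (f : Ω → ℝ) : Prop :=
  AEStronglyMeasurable f m.variation ∧
  (∀ x' : StrongDual ℝ X, Integrable f (scalarize m x').variation) ∧
  ∀ A : Set Ω, MeasurableSet A → ∃ x : X, IsIntegralOn m f A x

theorem scalarize_apply (m : VectorMeasure Ω X) (x' : StrongDual ℝ X) (A : Set Ω) :
    scalarize m x' A = x' (m A) := rfl

theorem scalarize_variation_ac (m : VectorMeasure Ω X) (x' : StrongDual ℝ X) :
    (scalarize m x').variation ≪ m.variation := by
  refine Measure.AbsolutelyContinuous.mk fun s hs h => ?_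
  rw [VectorMeasure.variation_apply_eq_zero hs] at h ⊢
  intro t hts ht
  simp [scalarize_apply, h t hts ht]

theorem variation_eq_zero_of_scalarize {m : VectorMeasure Ω X} {s : Set Ω} (hs : MeasurableSet s)
    (h : ∀ x' : StrongDual ℝ X, ‖x'‖ ≤ 1 → (scalarize m x').variation s = 0) :
    m.variation s = 0 := by
  rw [VectorMeasure.variation_apply_eq_zero hs]
  intro t hts ht
  obtain ⟨x', hx', h1⟩ := exists_dual_vector'' ℝ (m t)
  have h2 := (VectorMeasure.variation_apply_eq_zero hs).1 (h x' hx') t hts ht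
  rw [scalarize_apply, h1] at h2
  simpa using h2

theorem integral_of_nonneg {ν : SignedMeasure Ω} (hν : 0 ≤ ν) (f : Ω → ℝ) :
    ∫ᵛ ω, f ω ∂•ν = ∫ ω, f ω ∂ν.variation := by
  have h0 : VectorMeasure.restrict 0 univ ≤ ν.restrict univ := by simpa using hν
  have h1 : ν = (ν.toMeasureOfZeroLE univ MeasurableSet.univ h0).toSignedMeasure := by
    ext s hs
    rw [Measure.toSignedMeasure_apply_measurable hs,
      SignedMeasure.toMeasureOfZeroLE_real_apply _ h0 _ hs]
    simp
  have h2 : ContinuousLinearMap.lsmul ℝ ℝ = (ContinuousLinearMap.lsmul ℝ ℝ).flip (E := ℝ) := by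
    ext
    simp
  rw [h1, h2, VectorMeasure.integral_toSignedMeasure, Measure.variation_toSignedMeasure]

theorem exists_integral_variation_eq (ν : SignedMeasure Ω) {f : Ω → ℝ}
    (hf : Integrable f ν.variation) :
    ∃ s, MeasurableSet s ∧ ∫ ω, f ω ∂ν.variation =
      ∫ᵛ ω in s, f ω ∂•ν - ∫ᵛ ω in sᶜ, f ω ∂•ν := by
  obtain ⟨s, hs, hpos, hneg⟩ := ν.exists_compl_positive_negative
  refine ⟨s, hs, ?_⟩
  have e1 : ∫ᵛ ω in s, f ω ∂•ν = ∫ ω in s, f ω ∂ν.variation := by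
    rw [integral_of_nonneg (by simpa using hpos), VectorMeasure.variation_restrict hs]
  have e2 : ∫ᵛ ω in sᶜ, f ω ∂•ν = - ∫ ω in sᶜ, f ω ∂ν.variation := by
    have h : 0 ≤ -(ν.restrict sᶜ) := by
      have : ν.restrict sᶜ ≤ 0 := by simpa using hneg
      simpa using this
    have := integral_of_nonneg h f
    rw [VectorMeasure.integral_neg_vectorMeasure, VectorMeasure.variation_neg,
      VectorMeasure.variation_restrict hs.compl] at this
    linarith
  rw [e1, e2, sub_neg_eq_add, integral_add_compl hs hf]

theorem abs_integralOn_le (ν : SignedMeasure Ω) {f : Ω → ℝ} {s : Set Ω}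
    (hf : Integrable f ν.variation) :
    |∫ᵛ ω in s, f ω ∂•ν| ≤ ∫ ω, |f ω| ∂ν.variation := by
  have h := VectorMeasure.norm_integral_le_integral_norm (μ := ν.restrict s)
    (B := ContinuousLinearMap.lsmul ℝ ℝ) (f := f)
  rw [ContinuousLinearMap.opNorm_lsmul, one_mul] at h
  refine h.trans ?_
  exact integral_mono_measure (VectorMeasure.variation_restrict_le.trans Measure.restrict_le_self)
    (ae_of_all _ fun _ => norm_nonneg _) hf.norm

/-- A nonnegative integrable function has finite `L¹(m)`-norm. -/
theorem VMIntegrable.exists_bound {m : VectorMeasure Ω X} {f : Ω → ℝ} (hf : VMIntegrable m f) :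
    ∃ C : ℝ, 0 ≤ C ∧ ∀ x' : StrongDual ℝ X,
      ∫ ω, f ω ∂(scalarize m x').variation ≤ C * ‖x'‖ := by
  choose x hx using fun A : {A : Set Ω // MeasurableSet A} => hf.2.2 A A.2
  obtain ⟨C, hC⟩ := banach_steinhaus (g := fun A => NormedSpace.inclusionInDoubleDual ℝ X (x A))
    (fun x' => ⟨∫ ω, |f ω| ∂(scalarize m x').variation, fun A => by
      rw [NormedSpace.dual_def, hx A x']
      exact abs_integralOn_le _ (hf.2.1 x')⟩)
  have hC0 : 0 ≤ C := (norm_nonneg _).trans (hC ⟨∅, MeasurableSet.empty⟩)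
  refine ⟨2 * C, by positivity, fun x' => ?_⟩
  obtain ⟨s, hs, he⟩ := exists_integral_variation_eq (scalarize m x') (hf.2.1 x')
  rw [he, ← hx ⟨s, hs⟩ x', ← hx ⟨sᶜ, hs.compl⟩ x']
  have hb (A) : |x' (x A)| ≤ C * ‖x'‖ := by
    have := (NormedSpace.inclusionInDoubleDual ℝ X (x A)).le_of_opNorm_le (hC A) x'
    simpa [NormedSpace.dual_def] using this
  have h1 := abs_le.1 (hb ⟨s, hs⟩)
  have h2 := abs_le.1 (hb ⟨sᶜ, hs.compl⟩)
  linarith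

theorem VMIntegrable.add {m : VectorMeasure Ω X} {f g : Ω → ℝ} (hf : VMIntegrable m f)
    (hg : VMIntegrable m g) : VMIntegrable m (f + g) := by
  refine ⟨hf.1.add hg.1, fun x' => (hf.2.1 x').add (hg.2.1 x'), fun A hA => ?_⟩
  obtain ⟨x, hx⟩ := hf.2.2 A hA
  obtain ⟨y, hy⟩ := hg.2.2 A hA
  refine ⟨x + y, fun x' => ?_⟩
  have h1 : (scalarize m x').IntegrableOn f A := (hf.2.1 x').mono_measure
    (VectorMeasure.variation_restrict_le.trans Measure.restrict_le_self)
  have h2 : (scalarize m x').IntegrableOn g A := (hg.2.1 x').mono_measure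
    (VectorMeasure.variation_restrict_le.trans Measure.restrict_le_self)
  rw [map_add, hx x', hy x', VectorMeasure.integral_add h1 h2]

theorem VMIntegrable.smul {m : VectorMeasure Ω X} {f : Ω → ℝ} (hf : VMIntegrable m f)
    (c : ℝ) : VMIntegrable m (c • f) := by
  refine ⟨hf.1.const_smul c, fun x' => (hf.2.1 x').smul c, fun A hA => ?_⟩
  obtain ⟨x, hx⟩ := hf.2.2 A hA
  refine ⟨c • x, fun x' => ?_⟩
  rw [map_smul, hx x', VectorMeasure.integral_smul]

theorem ideal_simple {m : VectorMeasure Ω X} {F : Ω → ℝ} (hF : VMIntegrable m F) {A : Set Ω}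
    (hA : MeasurableSet A) (s : SimpleFunc Ω ℝ) : ∃ y, IsIntegralOn m (fun ω => s ω * F ω) A y := by
  induction s using SimpleFunc.induction with
  | @const c t ht =>
    obtain ⟨x, hx⟩ := hF.2.2 (A ∩ t) (hA.inter ht)
    refine ⟨c • x, fun x' => ?_⟩
    rw [map_smul, hx x', ← VectorMeasure.setIntegral_indicator hA ht, ← VectorMeasure.integral_smul]
    congr 1
    ext ω
    by_cases h : ω ∈ t <;> simp [h]
  | @add f g _ hf hg =>
    obtain ⟨x, hx⟩ := hf
    obtain ⟨y, hy⟩ := hg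
    refine ⟨x + y, fun x' => ?_⟩
    have key (f : SimpleFunc Ω ℝ) : (scalarize m x').IntegrableOn (fun ω => f ω * F ω) A := by
      obtain ⟨C, hC⟩ := f.exists_forall_norm_le
      exact ((hF.2.1 x').bdd_mul f.aestronglyMeasurable (ae_of_all _ hC)).mono_measure
        (VectorMeasure.variation_restrict_le.trans Measure.restrict_le_self)
    rw [map_add, hx x', hy x', ← VectorMeasure.integral_add (key f) (key g)]
    congr 1
    ext ω
    simp [add_mul]

theorem exists_simple_approx {φ : Ω → ℝ} (hφ : Measurable φ) (hb : ∀ ω, |φ ω| ≤ 1) {ε : ℝ}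
    (hε : 0 < ε) : ∃ s : SimpleFunc Ω ℝ, ∀ ω, |s ω - φ ω| ≤ ε := by
  let g : Ω → ℝ := fun ω => (⌊φ ω / ε⌋ : ℝ) * ε
  have hg : Measurable g := by
    have : Measurable fun ω => ⌊φ ω / ε⌋ := Int.measurable_floor.comp (hφ.div_const ε)
    exact (measurable_from_top.comp this).mul_const ε
  have hfin : (range g).Finite := by
    refine ((Set.finite_Icc ⌊-1 / ε⌋ ⌊1 / ε⌋).image (fun n : ℤ => (n : ℝ) * ε)).subset ?_
    rintro _ ⟨ω, rfl⟩
    have := abs_le.1 (hb ω)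
    exact ⟨⌊φ ω / ε⌋, ⟨Int.floor_mono (by gcongr; exact this.1),
      Int.floor_mono (by gcongr; exact this.2)⟩, rfl⟩
  refine ⟨⟨g, fun x => hg (measurableSet_singleton x), hfin⟩, fun ω => ?_⟩
  change |g ω - φ ω| ≤ ε
  have h1 := Int.floor_le (φ ω / ε)
  have h2 := Int.lt_floor_add_one (φ ω / ε)
  rw [le_div_iff₀ hε] at h1
  rw [div_lt_iff₀ hε] at h2
  rw [abs_le]
  simp only [g]
  constructor <;> nlinarith

theorem VMIntegrable.mono [CompleteSpace X] {m : VectorMeasure Ω X} {F h : Ω → ℝ}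
    (hF : VMIntegrable m F) (hh : AEStronglyMeasurable h m.variation)
    (hle : ∀ᵐ ω ∂m.variation, |h ω| ≤ F ω) : VMIntegrable m h := by
  have hint (x' : StrongDual ℝ X) : Integrable h (scalarize m x').variation :=
    (hF.2.1 x').mono' (hh.mono_ac (scalarize_variation_ac m x'))
      ((scalarize_variation_ac m x').ae_le hle)
  refine ⟨hh, hint, fun A hA => ?_⟩
  obtain ⟨C, hC0, hC⟩ := hF.exists_bound
  -- a bounded measurable factor
  obtain ⟨φ, hφm, hφb, hφ⟩ : ∃ φ : Ω → ℝ, Measurable φ ∧ (∀ ω, |φ ω| ≤ 1) ∧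
      ∀ᵐ ω ∂m.variation, h ω = φ ω * F ω := by
    let ψ : Ω → ℝ := fun ω => hh.mk h ω / hF.1.mk F ω
    have hψ : Measurable ψ :=
      hh.stronglyMeasurable_mk.measurable.div hF.1.stronglyMeasurable_mk.measurable
    refine ⟨fun ω => max (-1) (min 1 (ψ ω)), measurable_const.max (measurable_const.min hψ),
      fun ω => abs_le.2 ⟨le_max_left _ _, max_le (by norm_num) (min_le_left _ _)⟩, ?_⟩
    filter_upwards [hle, hh.ae_eq_mk, hF.1.ae_eq_mk] with ω h1 h2 h3
    have e : ψ ω = h ω / F ω := by simp [ψ, ← h2, ← h3]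
    rw [e]
    have hF0 : 0 ≤ F ω := (abs_nonneg _).trans h1
    rcases hF0.eq_or_lt with h0 | h0
    · rw [← h0] at h1 ⊢
      simpa using h1
    · have := abs_le.1 h1
      rw [min_eq_right (by rw [div_le_one h0]; exact this.2),
        max_eq_right (by rw [le_div_iff₀ h0]; linarith [this.1])]
      field_simp
  have hFnn : ∀ᵐ ω ∂m.variation, 0 ≤ F ω := by
    filter_upwards [hle] with ω h1 using (abs_nonneg _).trans h1
  choose s hs using fun n : ℕ => exists_simple_approx hφm hφb (ε := 1 / ((n : ℝ) + 1))
    (by positivity)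
  choose y hy using fun n => ideal_simple hF hA (s n)
  have hsint (n : ℕ) (x' : StrongDual ℝ X) :
      Integrable (fun ω => s n ω * F ω) (scalarize m x').variation := by
    obtain ⟨D, hD⟩ := (s n).exists_forall_norm_le
    exact (hF.2.1 x').bdd_mul (s n).aestronglyMeasurable (ae_of_all _ hD)
  have hon {f : Ω → ℝ} {x' : StrongDual ℝ X} (hf : Integrable f (scalarize m x').variation) :
      (scalarize m x').IntegrableOn f A :=
    hf.mono_measure (VectorMeasure.variation_restrict_le.trans Measure.restrict_le_self)
  have happ (n : ℕ) (x' : StrongDual ℝ X) :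
      |x' (y n) - ∫ᵛ ω in A, h ω ∂•(scalarize m x')| ≤ C * ‖x'‖ * (1 / ((n : ℝ) + 1)) := by
    rw [hy n x', ← VectorMeasure.integral_sub (hon (hsint n x')) (hon (hint x'))]
    refine (abs_integralOn_le _ ((hsint n x').sub (hint x'))).trans ?_
    calc ∫ ω, |s n ω * F ω - h ω| ∂(scalarize m x').variation
        ≤ ∫ ω, (1 / ((n : ℝ) + 1)) * F ω ∂(scalarize m x').variation := by
          refine integral_mono_ae ((hsint n x').sub (hint x')).abs ((hF.2.1 x').const_mul _) ?_
          filter_upwards [(scalarize_variation_ac m x').ae_le hφ,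
            (scalarize_variation_ac m x').ae_le hFnn] with ω h1 h2
          rw [h1, ← sub_mul, abs_mul, abs_of_nonneg h2]
          exact mul_le_mul_of_nonneg_right (hs n ω) h2
      _ ≤ _ := by
          rw [integral_const_mul, mul_comm]
          exact mul_le_mul_of_nonneg_right (hC x') (by positivity)
  have hcauchy : CauchySeq y := by
    refine cauchySeq_of_le_tendsto_0 (fun n : ℕ => 2 * C * (1 / ((n : ℝ) + 1))) ?_ ?_
    · intro n k N hn hk
      rw [dist_eq_norm]
      obtain ⟨x', hx', he⟩ := exists_dual_vector'' ℝ (y n - y k)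
      have he' : x' (y n) - x' (y k) = ‖y n - y k‖ := by rw [← map_sub]; simpa using he
      have h1 := abs_le.1 (happ n x')
      have h2 := abs_le.1 (happ k x')
      have aux (j : ℕ) (hj : N ≤ j) : C * ‖x'‖ * (1 / ((j : ℝ) + 1)) ≤ C * (1 / ((N : ℝ) + 1)) := by
        have : (N : ℝ) ≤ j := by exact_mod_cast hj
        gcongr
        exact mul_le_of_le_one_right hC0 hx'
      have := aux n hn
      have := aux k hk
      linarith [h1.1, h1.2, h2.1, h2.2]
    · simpa using (tendsto_one_div_add_atTop_nhds_zero_nat (𝕜 := ℝ)).const_mul (2 * C)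
  obtain ⟨x, hx⟩ := cauchySeq_tendsto_of_complete hcauchy
  refine ⟨x, fun x' => ?_⟩
  have t1 : Filter.Tendsto (fun n => x' (y n)) Filter.atTop (𝓝 (x' x)) :=
    (x'.continuous.tendsto x).comp hx
  have t2 : Filter.Tendsto (fun n => x' (y n)) Filter.atTop
      (𝓝 (∫ᵛ ω in A, h ω ∂•(scalarize m x'))) := by
    rw [tendsto_iff_norm_sub_tendsto_zero]
    refine squeeze_zero (fun _ => norm_nonneg _) (fun n => happ n x') ?_
    simpa using (tendsto_one_div_add_atTop_nhds_zero_nat (𝕜 := ℝ)).const_mul (C * ‖x'‖)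
  exact tendsto_nhds_unique t1 t2


/-- Membership in `L^p(m)` (for functions that are measurable modulo `m`-null sets): for `p < ∞` the
function `|f|^p` is integrable with respect to `m`, for `p = ∞` the function `f` is `m`-essentially
bounded. -/
def MemMLp (m : VectorMeasure Ω X) (p : ℝ≥0∞) (f : Ω → ℝ) : Prop :=
  if p = ∞ then MemLp f ∞ m.variation else VMIntegrable m fun ω => |f ω| ^ p.toReal

/-- The norm of `L^p(m)`: `sup_{‖x'‖ ≤ 1} (∫ |f|^p d|⟨m, x'⟩|)^(1/p)` for `p < ∞`, and the
essential supremum modulo `m`-null sets for `p = ∞`. -/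
noncomputable def mLpNorm (m : VectorMeasure Ω X) (p : ℝ≥0∞) (f : Ω → ℝ) : ℝ≥0∞ :=
  if p = ∞ then eLpNorm f ∞ m.variation
  else (⨆ x' ∈ {x' : StrongDual ℝ X | ‖x'‖ ≤ 1},
    ∫⁻ ω, ‖f ω‖ₑ ^ p.toReal ∂(scalarize m x').variation) ^ (1 / p.toReal)

theorem mLpNorm_of_ne_top (m : VectorMeasure Ω X) {p : ℝ≥0∞} (hp1 : 1 ≤ p) (hp : p ≠ ∞)
    (f : Ω → ℝ) : mLpNorm m p f =
      ⨆ x' ∈ {x' : StrongDual ℝ X | ‖x'‖ ≤ 1}, eLpNorm f p (scalarize m x').variation := by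
  have h0 : p ≠ 0 := (zero_lt_one.trans_le hp1).ne'
  have hpos : 0 < 1 / p.toReal := one_div_pos.2 (ENNReal.toReal_pos h0 hp)
  rw [mLpNorm, if_neg hp]
  have := fun g : StrongDual ℝ X → ℝ≥0∞ => (ENNReal.orderIsoRpow _ hpos).map_iSup₂
    (fun x' (_ : x' ∈ {x' : StrongDual ℝ X | ‖x'‖ ≤ 1}) => g x')
  simp only [ENNReal.orderIsoRpow_apply] at this
  rw [this]
  simp only [eLpNorm_eq_lintegral_rpow_enorm_toReal h0 hp]

theorem mLpNorm_congr (m : VectorMeasure Ω X) {p : ℝ≥0∞} (hp1 : 1 ≤ p) {f g : Ω → ℝ}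
    (h : f =ᵐ[m.variation] g) : mLpNorm m p f = mLpNorm m p g := by
  by_cases hp : p = ∞
  · simp only [mLpNorm, if_pos hp]
    exact eLpNorm_congr_ae h
  · simp only [mLpNorm_of_ne_top m hp1 hp]
    refine iSup_congr fun x' => iSup_congr fun _ => eLpNorm_congr_ae ((scalarize_variation_ac m x').ae_le h)

theorem mLpNorm_add_le (m : VectorMeasure Ω X) {p : ℝ≥0∞} (hp1 : 1 ≤ p) {f g : Ω → ℝ}
    (hf : AEStronglyMeasurable f m.variation) (hg : AEStronglyMeasurable g m.variation) :
    mLpNorm m p (f + g) ≤ mLpNorm m p f + mLpNorm m p g := by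
  by_cases hp : p = ∞
  · simp only [mLpNorm, if_pos hp]
    exact eLpNorm_add_le hf hg le_top
  · simp only [mLpNorm_of_ne_top m hp1 hp]
    refine iSup₂_le fun x' hx' => (eLpNorm_add_le (hf.mono_ac (scalarize_variation_ac m x'))
      (hg.mono_ac (scalarize_variation_ac m x')) hp1).trans (add_le_add ?_ ?_)
    · exact le_iSup₂ (f := fun x' (_ : x' ∈ {x' : StrongDual ℝ X | ‖x'‖ ≤ 1}) =>
        eLpNorm f p (scalarize m x').variation) x' hx'
    · exact le_iSup₂ (f := fun x' (_ : x' ∈ {x' : StrongDual ℝ X | ‖x'‖ ≤ 1}) =>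
        eLpNorm g p (scalarize m x').variation) x' hx'

theorem mLpNorm_smul (m : VectorMeasure Ω X) {p : ℝ≥0∞} (hp1 : 1 ≤ p) (c : ℝ) (f : Ω → ℝ) :
    mLpNorm m p (c • f) = ‖c‖ₑ * mLpNorm m p f := by
  by_cases hp : p = ∞
  · simp only [mLpNorm, if_pos hp]
    exact eLpNorm_const_smul c f _ _
  · simp only [mLpNorm_of_ne_top m hp1 hp, ENNReal.mul_iSup]
    exact iSup_congr fun x' => iSup_congr fun _ => eLpNorm_const_smul c f _ _

theorem ae_eq_zero_of_mLpNorm (m : VectorMeasure Ω X) {p : ℝ≥0∞} (hp1 : 1 ≤ p) {f : Ω → ℝ}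
    (hf : Measurable f) (h : mLpNorm m p f = 0) : f =ᵐ[m.variation] 0 := by
  have h0 : p ≠ 0 := (zero_lt_one.trans_le hp1).ne'
  by_cases hp : p = ∞
  · simp only [mLpNorm, if_pos hp] at h
    exact (eLpNorm_eq_zero_iff hf.aestronglyMeasurable (by simp)).1 h
  · rw [mLpNorm_of_ne_top m hp1 hp] at h
    simp only [ENNReal.iSup_eq_zero] at h
    refine variation_eq_zero_of_scalarize
      (s := {ω | f ω = 0}ᶜ) (hf (measurableSet_singleton 0)).compl fun x' hx' => ?_
    exact (eLpNorm_eq_zero_iff hf.aestronglyMeasurable h0).1 (h x' hx')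

theorem MemMLp.mLpNorm_lt_top {m : VectorMeasure Ω X} {p : ℝ≥0∞} (hp1 : 1 ≤ p) {f : Ω → ℝ}
    (hf : MemMLp m p f) : mLpNorm m p f < ∞ := by
  have h0 : p ≠ 0 := (zero_lt_one.trans_le hp1).ne'
  by_cases hp : p = ∞
  · simp only [mLpNorm, MemMLp, if_pos hp] at hf ⊢
    exact hf.2
  · simp only [mLpNorm, MemMLp, if_neg hp] at hf ⊢
    obtain ⟨C, hC0, hC⟩ := hf.exists_bound
    refine ENNReal.rpow_lt_top_of_nonneg (by positivity) (ne_top_of_le_ne_top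
      (ENNReal.ofReal_ne_top (r := C)) (iSup₂_le fun x' hx' => ?_))
    have e : ∀ ω, ‖f ω‖ₑ ^ p.toReal = ENNReal.ofReal (|f ω| ^ p.toReal) := fun ω => by
      rw [← ENNReal.ofReal_rpow_of_nonneg (abs_nonneg _) ENNReal.toReal_nonneg, ← Real.norm_eq_abs,
        ofReal_norm]
    simp only [e]
    rw [← ofReal_integral_eq_lintegral_ofReal (hf.2.1 x') (ae_of_all _ fun ω => by positivity)]
    exact ENNReal.ofReal_le_ofReal ((hC x').trans (mul_le_of_le_one_right hC0 hx'))

theorem VMIntegrable.zero (m : VectorMeasure Ω X) : VMIntegrable m fun _ => 0 :=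
  ⟨aestronglyMeasurable_const, fun _ => integrable_zero _ _ _, fun _ _ => ⟨0, fun x' => by
    rw [map_zero, VectorMeasure.integral_zero]⟩⟩

theorem MemMLp.zero (m : VectorMeasure Ω X) {p : ℝ≥0∞} (hp1 : 1 ≤ p) :
    MemMLp m p fun _ => 0 := by
  have h0 : p ≠ 0 := (zero_lt_one.trans_le hp1).ne'
  by_cases hp : p = ∞
  · simp only [MemMLp, if_pos hp]
    exact MemLp.zero'
  · simp only [MemMLp, if_neg hp, abs_zero, Real.zero_rpow (ENNReal.toReal_pos h0 hp).ne']
    exact VMIntegrable.zero m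

theorem MemMLp.smul {m : VectorMeasure Ω X} {p : ℝ≥0∞} {f : Ω → ℝ} (hf : MemMLp m p f) (c : ℝ) :
    MemMLp m p (c • f) := by
  by_cases hp : p = ∞
  · simp only [MemMLp, if_pos hp] at hf ⊢
    exact hf.const_smul c
  · simp only [MemMLp, if_neg hp] at hf ⊢
    convert hf.smul (|c| ^ p.toReal) using 1
    ext ω
    simp [abs_mul, Real.mul_rpow]

theorem MemMLp.add [CompleteSpace X] {m : VectorMeasure Ω X} {p : ℝ≥0∞} {f g : Ω → ℝ}
    (hfm : AEStronglyMeasurable f m.variation) (hgm : AEStronglyMeasurable g m.variation)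
    (hf : MemMLp m p f) (hg : MemMLp m p g) : MemMLp m p (f + g) := by
  by_cases hp : p = ∞
  · simp only [MemMLp, if_pos hp] at hf hg ⊢
    exact hf.add hg
  · simp only [MemMLp, if_neg hp] at hf hg ⊢
    refine ((hf.add hg).smul (2 ^ p.toReal)).mono ?_ (ae_of_all _ fun ω => ?_)
    · exact ((Real.continuous_rpow_const ENNReal.toReal_nonneg).comp
        continuous_abs).comp_aestronglyMeasurable (hfm.add hgm)
    · rw [abs_of_nonneg (by positivity)]
      simp only [Pi.smul_apply, Pi.add_apply, smul_eq_mul]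
      have h1 : |f ω + g ω| ≤ 2 * max |f ω| |g ω| := by
        have := abs_add_le (f ω) (g ω)
        linarith [le_max_left |f ω| |g ω|, le_max_right |f ω| |g ω|]
      calc |f ω + g ω| ^ p.toReal ≤ (2 * max |f ω| |g ω|) ^ p.toReal := by gcongr
        _ = 2 ^ p.toReal * (max |f ω| |g ω|) ^ p.toReal :=
          Real.mul_rpow (by norm_num) (by positivity)
        _ ≤ _ := by
          gcongr
          rcases max_choice |f ω| |g ω| with h | h <;> rw [h]
          · linarith [Real.rpow_nonneg (abs_nonneg (g ω)) p.toReal]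
          · linarith [Real.rpow_nonneg (abs_nonneg (f ω)) p.toReal]

theorem MemMLp.congr {m : VectorMeasure Ω X} {p : ℝ≥0∞} {f g : Ω → ℝ}
    (hf : MemMLp m p f) (h : f =ᵐ[m.variation] g) : MemMLp m p g := by
  by_cases hp : p = ∞
  · simp only [MemMLp, if_pos hp] at hf ⊢
    exact hf.ae_eq h
  · simp only [MemMLp, if_neg hp] at hf ⊢
    have h' : (fun ω => |f ω| ^ p.toReal) =ᵐ[m.variation] fun ω => |g ω| ^ p.toReal := by
      filter_upwards [h] with ω hω
      rw [hω]
    refine ⟨hf.1.congr h', fun x' => (hf.2.1 x').congr ((scalarize_variation_ac m x').ae_le h'),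
      fun A hA => ?_⟩
    obtain ⟨x, hx⟩ := hf.2.2 A hA
    refine ⟨x, fun x' => (hx x').trans (VectorMeasure.integral_congr_ae ?_)⟩
    rw [VectorMeasure.variation_restrict hA]
    exact ae_restrict_of_ae ((scalarize_variation_ac m x').ae_le h')

/-- The space `L^p(m)` of classes, modulo equality outside `m`-null sets, of functions that are
`p`-integrable with respect to `m` (essentially bounded if `p = ∞`). -/
def MLp [CompleteSpace X] (m : VectorMeasure Ω X) (p : ℝ≥0∞) [hp : Fact (1 ≤ p)] :
    Submodule ℝ (Ω →ₘ[m.variation] ℝ) where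
  carrier := {f | MemMLp m p f}
  zero_mem' := (MemMLp.zero m hp.out).congr AEEqFun.coeFn_zero.symm
  add_mem' {f g} hf hg := (MemMLp.add f.aestronglyMeasurable g.aestronglyMeasurable hf hg).congr
    (AEEqFun.coeFn_add f g).symm
  smul_mem' c f hf := (MemMLp.smul hf c).congr (AEEqFun.coeFn_smul c f).symm

section Norm

variable [CompleteSpace X] (m : VectorMeasure Ω X) (p : ℝ≥0∞) [hp : Fact (1 ≤ p)]

noncomputable instance : Norm (MLp m p) := ⟨fun f => (mLpNorm m p f.1).toReal⟩

theorem MLp.core : NormedSpace.Core ℝ (MLp m p) where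
  norm_nonneg _ := ENNReal.toReal_nonneg
  norm_smul c f := by
    change (mLpNorm m p (c • f.1 : Ω →ₘ[m.variation] ℝ)).toReal = ‖c‖ * (mLpNorm m p f.1).toReal
    rw [mLpNorm_congr m hp.out (AEEqFun.coeFn_smul c f.1), mLpNorm_smul m hp.out,
      ENNReal.toReal_mul, toReal_enorm]
  norm_triangle f g := by
    change (mLpNorm m p (f.1 + g.1 : Ω →ₘ[m.variation] ℝ)).toReal ≤
      (mLpNorm m p f.1).toReal + (mLpNorm m p g.1).toReal
    have hf := MemMLp.mLpNorm_lt_top hp.out f.2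
    have hg := MemMLp.mLpNorm_lt_top hp.out g.2
    rw [mLpNorm_congr m hp.out (AEEqFun.coeFn_add f.1 g.1), ← ENNReal.toReal_add hf.ne hg.ne]
    exact ENNReal.toReal_mono (ENNReal.add_lt_top.2 ⟨hf, hg⟩).ne
      (mLpNorm_add_le m hp.out f.1.aestronglyMeasurable g.1.aestronglyMeasurable)
  norm_eq_zero_iff f := by
    change (mLpNorm m p f.1).toReal = 0 ↔ f = 0
    rw [ENNReal.toReal_eq_zero_iff, or_iff_left (MemMLp.mLpNorm_lt_top hp.out f.2).ne]
    constructor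
    · intro h
      exact Subtype.ext (AEEqFun.ext ((ae_eq_zero_of_mLpNorm m hp.out
        f.1.stronglyMeasurable.measurable h).trans AEEqFun.coeFn_zero.symm))
    · rintro rfl
      have h0 : mLpNorm m p (0 : Ω → ℝ) = 0 := by
        simpa using mLpNorm_smul m hp.out 0 (0 : Ω → ℝ)
      rw [← h0]
      exact mLpNorm_congr m hp.out AEEqFun.coeFn_zero

noncomputable instance : NormedAddCommGroup (MLp m p) := NormedAddCommGroup.ofCore (MLp.core m p)

noncomputable instance : NormedSpace ℝ (MLp m p) := NormedSpace.ofCore (MLp.core m p)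

end Norm

open Classical in
/-- The integral `∫ f dm ∈ X`, over the whole space, of an `m`-integrable function `f`. -/
noncomputable def integral (m : VectorMeasure Ω X) (f : Ω → ℝ) : X :=
  if h : ∃ x, IsIntegralOn m f univ x then h.choose else 0

theorem VMIntegrable.integral_spec {m : VectorMeasure Ω X} {f : Ω → ℝ} (hf : VMIntegrable m f) :
    IsIntegralOn m f univ (integral m f) := by
  rw [integral, dif_pos (hf.2.2 univ MeasurableSet.univ)]
  exact (hf.2.2 univ MeasurableSet.univ).choose_spec

/-- `L^p(m) · L^{p'}(m) ⊆ L^1(m)`. -/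
theorem MLp.mul_integrable [CompleteSpace X] {m : VectorMeasure Ω X} {p p' : ℝ≥0∞}
    [Fact (1 ≤ p)] [Fact (1 ≤ p')] (hpp' : p.HolderConjugate p') (f : MLp m p) (g : MLp m p') :
    VMIntegrable m fun ω => f.1 ω * g.1 ω := by
  have hmeas : AEStronglyMeasurable (fun ω => f.1 ω * g.1 ω) m.variation :=
    f.1.aestronglyMeasurable.mul g.1.aestronglyMeasurable
  have hf : MemMLp m p f.1 := f.2
  have hg : MemMLp m p' g.1 := g.2
  by_cases hp : p = ∞
  · have hp' : p' = 1 := by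
      subst hp
      exact (ENNReal.HolderConjugate.unique ∞ p' 1)
    simp only [MemMLp, if_pos hp, hp', ENNReal.one_ne_top, if_false, ENNReal.toReal_one,
      Real.rpow_one] at hf hg
    refine (hg.smul (eLpNorm f.1 ∞ m.variation).toReal).mono hmeas ?_
    filter_upwards [ae_le_eLpNormEssSup (f := f.1) (μ := m.variation)] with ω hω
    rw [abs_mul]
    refine mul_le_mul_of_nonneg_right ?_ (abs_nonneg _)
    rw [← Real.norm_eq_abs, ← toReal_enorm]
    exact ENNReal.toReal_mono hf.2.ne (by simpa using hω)
  by_cases hq : p' = ∞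
  · have hp' : p = 1 := by
      subst hq
      exact (ENNReal.HolderConjugate.unique ∞ p 1)
    simp only [MemMLp, if_pos hq, hp', ENNReal.one_ne_top, if_false, ENNReal.toReal_one,
      Real.rpow_one] at hf hg
    refine (hf.smul (eLpNorm g.1 ∞ m.variation).toReal).mono hmeas ?_
    filter_upwards [ae_le_eLpNormEssSup (f := g.1) (μ := m.variation)] with ω hω
    rw [abs_mul, mul_comm]
    refine mul_le_mul_of_nonneg_right ?_ (abs_nonneg _)
    rw [← Real.norm_eq_abs, ← toReal_enorm]
    exact ENNReal.toReal_mono hg.2.ne (by simpa using hω)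
  simp only [MemMLp, if_neg hp, if_neg hq] at hf hg
  have hr : p.toReal.HolderConjugate p'.toReal := ENNReal.HolderConjugate.toReal_of_ne_top hp hq
  refine ((hf.smul p.toReal⁻¹).add (hg.smul p'.toReal⁻¹)).mono hmeas (ae_of_all _ fun ω => ?_)
  have := Real.young_inequality_of_nonneg (abs_nonneg (f.1 ω)) (abs_nonneg (g.1 ω)) hr
  rw [abs_mul]
  simpa [div_eq_inv_mul] using this

section DualSystem

variable [CompleteSpace X] {m : VectorMeasure Ω X} {p p' : ℝ≥0∞} [Fact (1 ≤ p)] [Fact (1 ≤ p')]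

/-- The vector valued duality `(f, g) ↦ ∫ f g dm` between `L^p(m)` and `L^{p'}(m)`. -/
noncomputable def pairing (f : MLp m p) (g : MLp m p') : X :=
  integral m fun ω => f.1 ω * g.1 ω

/-- `R` is `m`-norming for `P`: the function `f ↦ sup_{g ∈ B_R} ‖∫ f g dm‖` is equivalent to the
norm of `P`. -/
def IsMNorming (R : Submodule ℝ (MLp m p')) (P : Submodule ℝ (MLp m p)) : Prop :=
  ∃ c C : ℝ≥0, 0 < c ∧ ∀ f ∈ P,
    c * ‖f‖ₑ ≤ (⨆ g ∈ Metric.closedBall (0 : R) 1, ‖pairing f g.1‖ₑ) ∧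
    (⨆ g ∈ Metric.closedBall (0 : R) 1, ‖pairing f g.1‖ₑ) ≤ C * ‖f‖ₑ

/-- `(P, P^m, P^{mm})` is an `m`-dual system: `P^m ⊆ L^{p'}(m)` is `m`-norming for `P`, and
`P^{mm} ⊆ L^p(m)` contains `P` and is `m`-norming for `P^m`. -/
structure IsMDualSystem (P : Submodule ℝ (MLp m p)) (Pm : Submodule ℝ (MLp m p'))
    (Pmm : Submodule ℝ (MLp m p)) : Prop where
  norming : IsMNorming Pm P
  norming_dual : IsMNorming Pmm Pm
  le_bidual : P ≤ Pmm

/-- The topology `τ_m(R)` on `S` of pointwise convergence on `R` of the integrals. Since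
`f ↦ ∫ f g dm` is linear, it is the locally convex topology given by the seminorms
`f ↦ ‖∫ f g dm‖`, `g ∈ R`. -/
@[reducible] noncomputable def tauM (S : Submodule ℝ (MLp m p)) (R : Submodule ℝ (MLp m p')) : TopologicalSpace S :=
  TopologicalSpace.induced (fun (f : S) (g : R) => pairing f.1 g.1) Pi.topologicalSpace

/-- The closed unit ball `B_S` is `τ_m(R)`-compact. -/
def IsTauCompactBall (S : Submodule ℝ (MLp m p)) (R : Submodule ℝ (MLp m p')) : Prop :=
  @IsCompact S (tauM S R) (Metric.closedBall (0 : S) 1)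

/-- The operator `T : P → E` is `(q, R)`-summing. -/
def IsSumming {P : Submodule ℝ (MLp m p)} (q : ℝ) (R : Submodule ℝ (MLp m p')) {E : Type*}
    [NormedAddCommGroup E] [NormedSpace ℝ E] (T : P →L[ℝ] E) : Prop :=
  ∃ K : ℝ≥0, ∀ (n : ℕ) (f : Fin n → P),
    (∑ i, ‖T (f i)‖ₑ ^ q) ^ (1 / q) ≤
      K * ⨆ g ∈ Metric.closedBall (0 : R) 1, (∑ i, ‖pairing (f i).1 g.1‖ₑ ^ q) ^ (1 / q)

end DualSystem

end VectorMeasureLp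

/-! Everything follows from one fact: a `(q, P^m)`-summing operator `T` maps `B_P` onto a norm
compact set. Then `T`, and with it `T ∘ T`, is compact. If `T` is also bounded below, `B_P` itself
is norm compact, and Riesz's theorem gives finite dimension.

To prove the fact, view `B_{P^m}` as a compact Hausdorff space `K` of functions `Pmm → X`. Since `P
≤ Pmm`, each `f ∈ P` acts on `K` by evaluation, as a continuous map `K → X`, and
`τ_m(P^m)`-compactness turns `B_P` into a pointwise compact set of such maps. Such a set is
sequentially compact (`isSeqCompact_of_isCompact_of_continuous`), so every sequence in `B_P` has a
subsequence converging pointwise on `K` to some `f ∈ B_P`.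

It remains to pass from pointwise to norm convergence of the images
(`tendsto_norm_zero_of_summing`). For a bounded, pointwise null sequence `h n`, Hahn–Banach, Riesz
representation and dominated convergence produce convex combinations of the functions `‖h n‖ ^ q` on
`K` that are uniformly small (`exists_mem_convexHull_forall_lt`). The summing inequality accepts
weighted families, so the same weights make an average of the `‖T (h n)‖ ^ q` small; these norms
therefore cannot stay away from zero. This replaces a Pietsch domination theorem. -/

/-! ### Sequential compactness in the pointwise topology -/

open Filter in
/-- A pointwise compact set of continuous maps from a compact space to a metric space is
sequentially compact for the topology of pointwise convergence. -/
theorem isSeqCompact_of_isCompact_of_continuous {K X : Type*} [TopologicalSpace K] [CompactSpace K]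
    [MetricSpace X] {H : Set (K → X)} (hH : IsCompact H) (hc : ∀ h ∈ H, Continuous h) :
    IsSeqCompact H := by
  intro u hu
  -- `Φ` sends `K` to a compact metrizable, hence separable, image. Lifting a countable dense subset
  -- of it gives a countable `D ⊆ K` that suffices to test the sequence `u`.
  let Φ : K → ℕ → X := fun k n => u n k
  have hΦ : Continuous Φ := continuous_pi fun n => hc _ (hu n)
  obtain ⟨t, htr, htc, htd⟩ :=
    (isCompact_range hΦ).isSeparable.exists_countable_dense_subset
  choose s hs using fun x : t => htr x.2
  have := htc.to_subtype
  let D : Set K := range s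
  have hD : Countable D := (countable_range s).to_subtype
  let ρ : (K → X) → D → X := fun f d => f d
  have hρ : Continuous ρ := by fun_prop
  obtain ⟨w, -, ψ, hψ, hw⟩ := (hH.image hρ).isSeqCompact fun n => mem_image_of_mem ρ (hu n)
  -- A cluster point of the subsequence cannot separate points that no `u n` separates, so it
  -- factors through `Φ`.
  have factor {h : K → X} (hh : MapClusterPt h atTop (u ∘ ψ)) {k k' : K} (hk : Φ k = Φ k') :
      h k = h k' := by
    have hcl : IsClosed {f : K → X | f k = f k'} :=
      isClosed_eq (continuous_apply k) (continuous_apply k')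
    exact hcl.mem_of_mapClusterPt hh (Eventually.of_forall fun n => congrFun hk (ψ n))
  have onD {h : K → X} (hh : MapClusterPt h atTop (u ∘ ψ)) : ρ h = w := by
    have h1 : MapClusterPt (ρ h) atTop (ρ ∘ (u ∘ ψ)) := hh.continuousAt_comp hρ.continuousAt
    exact eq_of_nhds_neBot (h1.clusterPt.mono hw)
  -- The coincidence set `Z` is closed, so `Φ '' Z` is compact. It contains the dense set `t` and is
  -- therefore all of `range Φ`; `factor` then carries equality from `Z` to all of `K`.
  have uniq {h h' : K → X} (hm : h ∈ H) (hm' : h' ∈ H) (hh : MapClusterPt h atTop (u ∘ ψ))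
      (hh' : MapClusterPt h' atTop (u ∘ ψ)) : h = h' := by
    let Z : Set K := {k | h k = h' k}
    have hZ : IsClosed Z := isClosed_eq (hc _ hm) (hc _ hm')
    have hsub : t ⊆ Φ '' Z := fun x hx =>
      ⟨s ⟨x, hx⟩, congrFun ((onD hh).trans (onD hh').symm) ⟨_, mem_range_self _⟩, hs ⟨x, hx⟩⟩
    have hall := htd.trans (closure_minimal hsub (hZ.isCompact.image hΦ).isClosed)
    ext k
    obtain ⟨k', hk', he⟩ := hall (mem_range_self k)
    rw [← factor hh he, ← factor hh' he]
    exact hk'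
  obtain ⟨h, hm, hh⟩ := hH.exists_mapClusterPt (f := atTop) (u := u ∘ ψ)
    (tendsto_principal.2 (Eventually.of_forall fun n => hu (ψ n)))
  exact ⟨h, hm, ψ, hψ, hH.tendsto_nhds_of_unique_mapClusterPt
    (Eventually.of_forall fun n => hu (ψ n)) fun h' hm' hh' => uniq hm' hm hh' hh⟩

/-! ### Uniformly small convex combinations -/

open Filter in
/-- A bounded pointwise null sequence of nonnegative continuous functions on a compact space has
uniformly small convex combinations. -/
theorem exists_mem_convexHull_forall_lt {K : Type*} [TopologicalSpace K] [CompactSpace K]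
    [T2Space K] {u : ℕ → C(K, ℝ)} {M : ℝ} (hM : ∀ n k, |u n k| ≤ M)
    (hu : ∀ k, Tendsto (fun n => u n k) atTop (𝓝 0)) {δ : ℝ} (hδ : 0 < δ) :
    ∃ v ∈ convexHull ℝ (range u), ∀ k, v k < δ := by
  by_contra! hcon
  let s : Set C(K, ℝ) := {v | ∀ k, v k < δ}
  have hsc : Convex ℝ s := by
    intro v hv w hw a b ha hb hab k
    have h1 := hv k
    have h2 := hw k
    simp only [ContinuousMap.add_apply, ContinuousMap.smul_apply, smul_eq_mul]
    rcases ha.eq_or_lt with rfl | ha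
    · rw [zero_add] at hab
      subst hab
      linarith
    · nlinarith
  have hso : IsOpen s := by
    have := ContinuousMap.isOpen_setOfPred_mapsTo (X := K) (Y := ℝ) isCompact_univ (isOpen_Iio (a := δ))
    simpa [MapsTo, s] using this
  have hdisj : Disjoint s (convexHull ℝ (range u)) := by
    rw [Set.disjoint_left]
    intro v hv hv'
    obtain ⟨k, hk⟩ := hcon v hv'
    exact absurd (hv k) (not_lt.2 hk)
  obtain ⟨L, c, hL1, hL2⟩ := geometric_hahn_banach_open hsc hso (convex_convexHull ℝ _) hdisj
  have hc : 0 < c := by simpa using hL1 0 fun k => by simpa using hδ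
  -- `L` is bounded above by `c` on `s`, and `s` contains every nonpositive function. If `L w < 0`
  -- with `w ≥ 0`, the nonpositive multiple of `w` on which `L` equals `c` contradicts the strict
  -- bound.
  have hpos (w : C(K, ℝ)) (hw : ∀ k, 0 ≤ w k) : 0 ≤ L w := by
    by_contra! hneg
    have := hL1 ((c / L w) • w) fun k => by
      refine lt_of_le_of_lt ?_ hδ
      exact mul_nonpos_of_nonpos_of_nonneg (div_nonpos_of_nonneg_of_nonpos hc.le hneg.le) (hw k)
    rw [map_smul, smul_eq_mul, div_mul_cancel₀ _ hneg.ne] at this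
    exact lt_irrefl _ this
  let := borel K
  have : BorelSpace K := ⟨rfl⟩
  -- On a compact space every continuous function has compact support, so Riesz represents `L` by a
  -- finite measure.
  let l : CompactlySupportedContinuousMap K ℝ →ₗ[ℝ] ℝ :=
    { toFun f := L f.toContinuousMap
      map_add' f g := map_add L f.toContinuousMap g.toContinuousMap
      map_smul' a f := map_smul L a f.toContinuousMap }
  let Λ := PositiveLinearMap.mk₀ l fun f hf => hpos f.toContinuousMap hf
  have hint (f : C(K, ℝ)) : ∫ k, f k ∂(RealRMK.rieszMeasure Λ) = L f :=
    RealRMK.integral_rieszMeasure Λ (CompactlySupportedContinuousMap.continuousMapEquiv f)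
  have hlim : Tendsto (fun n => ∫ k, u n k ∂(RealRMK.rieszMeasure Λ)) atTop
      (𝓝 (∫ _, 0 ∂(RealRMK.rieszMeasure Λ))) :=
    tendsto_integral_of_dominated_convergence (fun _ => M)
      (fun n => (u n).continuous.aestronglyMeasurable) (integrable_const _)
      (fun n => ae_of_all _ (hM n)) (ae_of_all _ hu)
  rw [integral_zero] at hlim
  -- Separation keeps `L (u n) ≥ c > 0`, while dominated convergence sends these integrals to `0`.
  refine absurd (ge_of_tendsto' hlim fun n => ?_) (not_le.2 hc)
  rw [hint]
  exact hL2 _ (subset_convexHull ℝ _ (mem_range_self n))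

/-! ### Summing operators relative to a compact space -/

open Filter in
/-- A `q`-summing operator, relative to a family of vector valued functions on a compact space, maps
uniformly bounded pointwise null sequences to norm null sequences. -/
theorem tendsto_norm_zero_of_summing {V E X K : Type*} [AddCommGroup V] [Module ℝ V]
    [NormedAddCommGroup E] [NormedSpace ℝ E] [NormedAddCommGroup X] [NormedSpace ℝ X]
    [TopologicalSpace K] [CompactSpace K] [T2Space K] {φ : V →ₗ[ℝ] K → X}
    (hφ : ∀ f, Continuous (φ f)) {T : V →ₗ[ℝ] E} {q A : ℝ} (hq : 0 < q) (hA : 0 ≤ A)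
    (hT : ∀ (n : ℕ) (f : Fin n → V) (b : ℝ), 0 ≤ b → (∀ k, ∑ i, ‖φ (f i) k‖ ^ q ≤ b) →
      ∑ i, ‖T (f i)‖ ^ q ≤ A * b)
    {h : ℕ → V} {M : ℝ} (hM : ∀ n k, ‖φ (h n) k‖ ≤ M)
    (hh : ∀ k, Tendsto (fun n => φ (h n) k) atTop (𝓝 0)) :
    Tendsto (fun n => ‖T (h n)‖) atTop (𝓝 0) := by
  by_contra hcon
  obtain ⟨δ, hδ, hfreq⟩ : ∃ δ > 0, ∃ᶠ n in atTop, δ ≤ ‖T (h n)‖ := by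
    rw [Metric.tendsto_nhds] at hcon
    push Not at hcon
    simpa using hcon
  obtain ⟨ψ, hψ, hge⟩ := extraction_of_frequently_atTop hfreq
  let u : ℕ → C(K, ℝ) := fun n =>
    ⟨fun k => ‖φ (h (ψ n)) k‖ ^ q, ((hφ _).norm).rpow_const fun _ => Or.inr hq.le⟩
  have hδq : 0 < δ ^ q := Real.rpow_pos_of_pos hδ q
  obtain ⟨v, hv, hvlt⟩ := exists_mem_convexHull_forall_lt (u := u) (M := M ^ q)
    (fun n k => by
      change |‖φ (h (ψ n)) k‖ ^ q| ≤ _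
      rw [abs_of_nonneg (by positivity)]
      exact Real.rpow_le_rpow (norm_nonneg _) (hM _ _) hq.le)
    (fun k => by
      have := (((hh k).comp hψ.tendsto_atTop).norm).rpow_const (p := q) (Or.inr hq.le)
      rw [norm_zero, Real.zero_rpow hq.ne'] at this
      exact this)
    -- This threshold makes `A` times it strictly less than `δ ^ q`; the `+ 1` also covers `A = 0`.
    (δ := δ ^ q / (A + 1)) (by positivity)
  rw [mem_convexHull_iff_exists_fintype] at hv
  obtain ⟨ι, _, w, z, hw0, hw1, hz, rfl⟩ := hv
  choose j hj using hz
  let e := Fintype.equivFin ι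
  -- By homogeneity the factor `w ^ q⁻¹` becomes the weight `w` after taking norms to the power `q`,
  -- both under `φ` and under `T`.
  let f : Fin (Fintype.card ι) → V := fun i => (w (e.symm i) ^ q⁻¹) • h (ψ (j (e.symm i)))
  have hscale (i : ι) (r : ℝ) (hr : 0 ≤ r) : (‖w i ^ q⁻¹‖ * r) ^ q = w i * r ^ q := by
    rw [Real.mul_rpow (norm_nonneg _) hr, Real.norm_of_nonneg (Real.rpow_nonneg (hw0 i) _),
      Real.rpow_inv_rpow (hw0 i) hq.ne']
  have h1 := hT _ f (δ ^ q / (A + 1)) (by positivity) fun k => by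
    refine le_of_eq_of_le ?_ (hvlt k).le
    rw [ContinuousMap.sum_apply, ← e.symm.sum_comp]
    refine Finset.sum_congr rfl fun i _ => ?_
    simp only [f, map_smul, Pi.smul_apply, norm_smul, hscale _ _ (norm_nonneg _), ← hj]
    rfl
  have h2 : δ ^ q ≤ ∑ i, ‖T (f i)‖ ^ q := by
    calc δ ^ q = ∑ i, w i * δ ^ q := by rw [← Finset.sum_mul, hw1, one_mul]
      _ ≤ ∑ i, w i * ‖T (h (ψ (j i)))‖ ^ q := by
        gcongr with i
        · exact hw0 i
        · exact hge _
      _ = ∑ i, ‖T (f i)‖ ^ q := by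
        rw [← e.symm.sum_comp]
        refine Finset.sum_congr rfl fun i _ => ?_
        simp only [f, map_smul, norm_smul, hscale _ _ (norm_nonneg _)]
  have h3 : A * (δ ^ q / (A + 1)) < δ ^ q := by
    rw [mul_div_assoc', div_lt_iff₀ (by positivity)]
    nlinarith
  linarith

open Filter in
/-- A `q`-summing operator maps a set whose trace on the compact space is pointwise compact and
uniformly bounded onto a compact set. -/
theorem isCompact_image_of_summing {V E X K : Type*} [AddCommGroup V] [Module ℝ V]
    [NormedAddCommGroup E] [NormedSpace ℝ E] [NormedAddCommGroup X] [NormedSpace ℝ X]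
    [TopologicalSpace K] [CompactSpace K] [T2Space K] {φ : V →ₗ[ℝ] K → X}
    (hφ : ∀ f, Continuous (φ f)) {T : V →ₗ[ℝ] E} {q A : ℝ} (hq : 0 < q) (hA : 0 ≤ A)
    (hT : ∀ (n : ℕ) (f : Fin n → V) (b : ℝ), 0 ≤ b → (∀ k, ∑ i, ‖φ (f i) k‖ ^ q ≤ b) →
      ∑ i, ‖T (f i)‖ ^ q ≤ A * b)
    {B : Set V} {M : ℝ} (hM : ∀ f ∈ B, ∀ k, ‖φ f k‖ ≤ M) (hB : IsCompact (φ '' B)) :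
    IsCompact (T '' B) := by
  refine isCompact_iff_isSeqCompact.2 fun y hy => ?_
  choose x hxB hx using hy
  obtain ⟨_, ⟨f, hf, rfl⟩, ψ, hψ, hlim⟩ := isSeqCompact_of_isCompact_of_continuous hB
    (by rintro _ ⟨f, -, rfl⟩; exact hφ f) fun n => mem_image_of_mem φ (hxB n)
  refine ⟨T f, mem_image_of_mem T hf, ψ, hψ, ?_⟩
  rw [tendsto_iff_norm_sub_tendsto_zero]
  -- The differences from the limit are pointwise null on `K` and bounded by `M + M`.
  have := tendsto_norm_zero_of_summing hφ hq hA hT (h := fun n => x (ψ n) - f) (M := M + M)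
    (fun n k => by
      rw [map_sub, Pi.sub_apply]
      exact (norm_sub_le _ _).trans (add_le_add (hM _ (hxB _) k) (hM _ hf k)))
    (fun k => by
      have := ((tendsto_pi_nhds.1 hlim k).sub_const (φ f k))
      simpa using this)
  simpa [hx] using this

theorem sum_enorm_rpow_eq_ofReal {ι F : Type*} [SeminormedAddCommGroup F] (s : Finset ι)
    (y : ι → F) {q : ℝ} (hq : 0 ≤ q) :
    ∑ i ∈ s, ‖y i‖ₑ ^ q = ENNReal.ofReal (∑ i ∈ s, ‖y i‖ ^ q) := by
  rw [ENNReal.ofReal_sum_of_nonneg fun i _ => by positivity]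
  simp only [← ENNReal.ofReal_rpow_of_nonneg (norm_nonneg _) hq, ofReal_norm]

/-! ### Linearity of the pairing and application to the dual system -/

namespace VectorMeasureLp

section Pairing

variable {Ω : Type*} {mΩ : MeasurableSpace Ω} {X : Type*} [NormedAddCommGroup X] [NormedSpace ℝ X]

theorem IsIntegralOn.unique {m : VectorMeasure Ω X} {f : Ω → ℝ} {A : Set Ω} {x y : X}
    (hx : IsIntegralOn m f A x) (hy : IsIntegralOn m f A y) : x = y :=
  (SeparatingDual.eq_iff_forall_dual_eq (R := ℝ)).2 fun x' => (hx x').trans (hy x').symm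

theorem integral_congr {m : VectorMeasure Ω X} {f g : Ω → ℝ} (hf : VMIntegrable m f)
    (hg : VMIntegrable m g) (h : f =ᵐ[m.variation] g) : integral m f = integral m g := by
  refine hf.integral_spec.unique fun x' => (hg.integral_spec x').trans ?_
  refine VectorMeasure.integral_congr_ae ?_
  rw [VectorMeasure.variation_restrict MeasurableSet.univ]
  exact ae_restrict_of_ae ((scalarize_variation_ac m x').ae_le h.symm)

theorem integral_add {m : VectorMeasure Ω X} {f g : Ω → ℝ} (hf : VMIntegrable m f)
    (hg : VMIntegrable m g) : integral m (f + g) = integral m f + integral m g := by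
  refine (hf.add hg).integral_spec.unique fun x' => ?_
  have on {f : Ω → ℝ} (hf : VMIntegrable m f) : (scalarize m x').IntegrableOn f univ :=
    (hf.2.1 x').mono_measure
      (VectorMeasure.variation_restrict_le.trans Measure.restrict_le_self)
  rw [map_add, hf.integral_spec x', hg.integral_spec x', VectorMeasure.integral_add (on hf) (on hg)]

theorem integral_smul {m : VectorMeasure Ω X} {f : Ω → ℝ} (hf : VMIntegrable m f) (c : ℝ) :
    integral m (c • f) = c • integral m f := by
  refine (hf.smul c).integral_spec.unique fun x' => ?_
  rw [map_smul, hf.integral_spec x', VectorMeasure.integral_smul]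

variable [CompleteSpace X] {m : VectorMeasure Ω X} {p p' : ℝ≥0∞} [Fact (1 ≤ p)] [Fact (1 ≤ p')]

theorem pairing_comm (f : MLp m p) (g : MLp m p') : pairing f g = pairing g f := by
  simp only [pairing, mul_comm]

theorem pairing_add_left (hpp' : p.HolderConjugate p') (f₁ f₂ : MLp m p) (g : MLp m p') :
    pairing (f₁ + f₂) g = pairing f₁ g + pairing f₂ g := by
  have h1 := MLp.mul_integrable hpp' f₁ g
  have h2 := MLp.mul_integrable hpp' f₂ g
  refine (integral_congr (MLp.mul_integrable hpp' _ g) (h1.add h2) ?_).trans (integral_add h1 h2)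
  filter_upwards [AEEqFun.coeFn_add f₁.1 f₂.1] with ω hω
  simp [hω, add_mul]

theorem pairing_smul_left (hpp' : p.HolderConjugate p') (c : ℝ) (f : MLp m p) (g : MLp m p') :
    pairing (c • f) g = c • pairing f g := by
  have h := MLp.mul_integrable hpp' f g
  refine (integral_congr (MLp.mul_integrable hpp' _ g) (h.smul c) ?_).trans (integral_smul h c)
  filter_upwards [AEEqFun.coeFn_smul c f.1] with ω hω
  simp [hω, mul_assoc]

/-- A `(q, P^m)`-summing operator maps the unit ball of `P` onto a compact set. -/
theorem IsSumming.isCompact_image_closedBall (hpp' : p.HolderConjugate p')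
    {P Pmm : Submodule ℝ (MLp m p)} {Pm : Submodule ℝ (MLp m p')} (hsys : IsMDualSystem P Pm Pmm)
    (hP : IsTauCompactBall P Pm) (hPm : IsTauCompactBall Pm Pmm) {q : ℝ} (hq : 1 ≤ q) {E : Type*}
    [NormedAddCommGroup E] [NormedSpace ℝ E] {T : P →L[ℝ] E} (hT : IsSumming q Pm T) :
    IsCompact (T '' Metric.closedBall 0 1) := by
  have hq0 : 0 < q := zero_lt_one.trans_le hq
  let β : Pm → Pmm → X := fun g f => pairing g.1 f.1
  -- Passing from the ball to its image in a product of copies of `X` makes the Hausdorff property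
  -- automatic.
  let K : Set (Pmm → X) := β '' Metric.closedBall 0 1
  have hK : IsCompact K := by
    let : TopologicalSpace Pm := tauM Pm Pmm
    exact IsCompact.image hPm continuous_induced_dom
  have : CompactSpace K := isCompact_iff_compactSpace.1 hK
  -- Evaluation at `k` makes continuity on `K` immediate; a representative `γ k` in the ball
  -- supplies linearity and the norm bound.
  choose γ hγ hγk using fun k : K => k.2
  have eval (f : P) (k : K) : k.1 ⟨f.1, hsys.le_bidual f.2⟩ = pairing f.1 (γ k).1 := by
    rw [pairing_comm, ← hγk k]
  let φ : P →ₗ[ℝ] K → X :=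
    { toFun f k := k.1 ⟨f.1, hsys.le_bidual f.2⟩
      map_add' f₁ f₂ := by
        ext k
        simp only [Pi.add_apply, eval]
        exact pairing_add_left hpp' _ _ _
      map_smul' c f := by
        ext k
        simp only [Pi.smul_apply, eval]
        exact pairing_smul_left hpp' _ _ _ }
  have hφe (f : P) (k : K) : φ f k = pairing f.1 (γ k).1 := eval f k
  have hφ (f : P) : Continuous (φ f) := (continuous_apply _).comp continuous_subtype_val
  have hball : IsCompact (φ '' Metric.closedBall 0 1) := by
    -- Here `τ_m(P^m)` replaces the norm topology on `P`; each coordinate of `φ` is continuous for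
    -- it because it is a pairing with a fixed `γ k`.
    let : TopologicalSpace P := tauM P Pm
    refine IsCompact.image hP (continuous_pi fun k => ?_)
    simp only [hφe]
    exact (continuous_apply (γ k)).comp
      (continuous_induced_dom (f := fun (f : P) (g : Pm) => pairing f.1 g.1))
  obtain ⟨_, C, -, hC⟩ := hsys.norming
  have hbound (f : P) (hf : f ∈ Metric.closedBall (0 : P) 1) (k : K) : ‖φ f k‖ ≤ C := by
    have h1 : ‖φ f k‖ₑ ≤ C * ‖f.1‖ₑ := by
      rw [hφe]
      exact (le_iSup₂ (f := fun (g : Pm) (_ : g ∈ Metric.closedBall (0 : Pm) 1) =>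
        ‖pairing f.1 g.1‖ₑ) (γ k) (hγ k)).trans (hC f.1 f.2).2
    have h2 : ‖f.1‖ ≤ 1 := by simpa using hf
    have h3 : ‖φ f k‖ ≤ C * ‖f.1‖ := by
      rw [enorm_eq_nnnorm, enorm_eq_nnnorm] at h1
      exact_mod_cast h1
    exact h3.trans (mul_le_of_le_one_right C.2 h2)
  obtain ⟨A, hA⟩ := hT
  -- Raising the summing inequality to the power `q` turns its constant into `A ^ q`.
  refine isCompact_image_of_summing hφ (T := T.toLinearMap) (A := A ^ q) hq0 (by positivity)
    (fun n f b hb hle => ?_) hbound hball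
  -- Every `g` in the ball defines the point `β g` of `K`, so a bound on `K` controls the supremum
  -- over the whole ball.
  have hsup : (⨆ g ∈ Metric.closedBall (0 : Pm) 1,
      (∑ i, ‖pairing (f i).1 g.1‖ₑ ^ q) ^ (1 / q)) ≤ ENNReal.ofReal b ^ (1 / q) := by
    refine iSup₂_le fun g hg => ?_
    gcongr
    rw [sum_enorm_rpow_eq_ofReal _ _ hq0.le]
    refine ENNReal.ofReal_le_ofReal (le_of_eq_of_le ?_ (hle ⟨β g, mem_image_of_mem β hg⟩))
    exact Finset.sum_congr rfl fun i _ => by rw [pairing_comm]; rfl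
  have h1 := ENNReal.rpow_le_rpow ((hA n f).trans (mul_le_mul_right hsup _)) hq0.le
  rw [one_div, ENNReal.mul_rpow_of_nonneg _ _ hq0.le, ENNReal.rpow_inv_rpow hq0.ne',
    ENNReal.rpow_inv_rpow hq0.ne', sum_enorm_rpow_eq_ofReal _ _ hq0.le] at h1
  have h2 : (A : ℝ≥0∞) ^ q * ENNReal.ofReal b = ENNReal.ofReal ((A : ℝ) ^ q * b) := by
    rw [ENNReal.ofReal_mul (by positivity), ← ENNReal.ofReal_rpow_of_nonneg A.coe_nonneg hq0.le,
      ENNReal.ofReal_coe_nnreal]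
  rw [h2] at h1
  exact (ENNReal.ofReal_le_ofReal_iff (by positivity)).1 h1

end Pairing

end VectorMeasureLp

/-! ### The two conclusions -/

theorem corollary3p4 {Ω : Type*} {mΩ : MeasurableSpace Ω}
    {X : Type*} [NormedAddCommGroup X] [NormedSpace ℝ X] [CompleteSpace X]
    (hX : Function.Surjective (NormedSpace.inclusionInDoubleDual ℝ X))
    (m : MeasureTheory.VectorMeasure Ω X)
    (p p' : ℝ≥0∞) [Fact (1 ≤ p)] [Fact (1 ≤ p')] (hpp' : p.HolderConjugate p')
    (P : Submodule ℝ (VectorMeasureLp.MLp m p)) (Pm : Submodule ℝ (VectorMeasureLp.MLp m p'))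
    (Pmm : Submodule ℝ (VectorMeasureLp.MLp m p))
    (hsys : VectorMeasureLp.IsMDualSystem P Pm Pmm)
    (hP : VectorMeasureLp.IsTauCompactBall P Pm)
    (hPm : VectorMeasureLp.IsTauCompactBall Pm Pmm)
    (q : ℝ) (hq : 1 ≤ q) :
    (∀ T : P →L[ℝ] P, VectorMeasureLp.IsSumming q Pm T → IsCompactOperator (T ∘ T)) ∧
    (∀ (E : Type*) [NormedAddCommGroup E] [NormedSpace ℝ E] (T : P →L[ℝ] E),
      VectorMeasureLp.IsSumming q Pm T → (∃ c : ℝ, 0 < c ∧ ∀ f : P, c * ‖f‖ ≤ ‖T f‖) →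
        FiniteDimensional ℝ P) := by
  constructor
  · intro T hT
    -- Already `T` is compact: the preimage of the compact set `T(B_P)` contains the unit ball, a
    -- neighbourhood of `0`.
    have hc : IsCompactOperator T :=
      ⟨_, hT.isCompact_image_closedBall hpp' hsys hP hPm hq,
        Filter.mem_of_superset (Metric.closedBall_mem_nhds 0 one_pos) (subset_preimage_image _ _)⟩
    exact hc.comp_clm T
  · rintro E _ _ T hT ⟨c, hc, hle⟩
    have hcomp := hT.isCompact_image_closedBall hpp' hsys hP hPm hq
    have hanti : AntilipschitzWith (Real.toNNReal c⁻¹) T :=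
      AddMonoidHomClass.antilipschitz_of_bound T fun f => by
        rw [Real.coe_toNNReal _ (by positivity), ← div_eq_inv_mul, le_div_iff₀ hc, mul_comm]
        exact hle f
    -- Being bounded below, `T` induces the topology of `P`, so compactness of `T(B_P)` pulls back
    -- to `B_P`.
    have hind : Topology.IsInducing T := (hanti.isUniformInducing T.uniformContinuous).isInducing
    exact FiniteDimensional.of_isCompact_closedBall₀ ℝ one_pos (hind.isCompact_iff.2 hcomp)
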